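/- A betweenness structure is a pair $\mathcal B=(X,\beta)$ with $X$ a nonempty finite set and $\beta\subseteq X^3$; write $(x\,y\,z)$ for $(x,y,z)\in\beta$. It is almost-metrizable if for all $x,y,z,w\in X$: (P1) $(x\,x\,z)$; (P2) $(x\,y\,z)\Rightarrow(z\,y\,x)$; (P3) $(x\,y\,z)\wedge(y\,x\,z)\Rightarrow x=y$; (P4) $(x\,y\,z)\wedge(x\,w\,y)\Rightarrow(x\,w\,z)\wedge(w\,y\,z)$. The order of $\mathcal B$ is $|X|$. A three-element subset of $X$ is collinear if its elements can be named $x,y,z$ so that $(x\,y\,z)$ holds, and is a triangle otherwise; the co-size of $\mathcal B$ is its number of triangles. For integers $n,m$ let $B(n,m)$ be the class of almost-metrizable betweenness structures of order $n$ and co-size $m$. For integers $k,c$ put $$\gamma(k,c)=\max\{n\in\mathbb Z: B(n,kn-c)\neq\emptyset\},\qquad \sigma(k,c)=\max\{n\in\mathbb Z: B(n,kn-c)=\emptyset\},$$ where the maximum of a set of integers that is not bounded above is $\infty$ (and that of the empty set is $-\infty$), and $$\vartheta_{\min}(k)=\min\{c\in\mathbb Z:\gamma(k,c)=\infty\},\qquad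 \vartheta_{\max}(k)=\max\{c\in\mathbb Z:\gamma(k,c)=\infty\}.$$ Then $\vartheta_{\min}(1)=2$ and $\vartheta_{\max}(1)=4$ (in particular this minimum and this maximum exist), and for every integer $c$ $$\sigma(1,c)=\begin{cases}c-1&\text{if }2\le c\le 4,\\ \infty&\text{otherwise,}\end{cases}\qquad \gamma(1,c)=\begin{cases}10-c&\text{if }c<2,\\ \infty&\text{if }2\le c\le 4,\\ c&\text{if }c>4.\end{cases}$$ -/

import Mathlib

/-- A betweenness structure: a nonempty finite ground set with a ternary relation;
`between x y z` reads `y` is between `x` and `z`. -/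
structure BetweennessStructure where
  Point : Type
  finite : Finite Point
  nonempty : Nonempty Point
  between : Point → Point → Point → Prop

namespace BetweennessStructure

/-- The number of points. -/
noncomputable def order (B : BetweennessStructure) : ℕ := Nat.card B.Point

/-- The elementary properties of metric betweenness, the last one being the four relations
property. -/
structure AlmostMetrizable (B : BetweennessStructure) : Prop where
  refl_left : ∀ x z, B.between x x z
  symm : ∀ x y z, B.between x y z → B.between z y x
  antisymm : ∀ x y z, B.between x y z → B.between y x z → x = y
  four_relations : ∀ x y z w,
    B.between x y z → B.between x w y → B.between x w z ∧ B.between w y z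

/-- A set of points is a collinear triple if it has three elements, one of which is between the
other two. -/
def IsCollinearTriple (B : BetweennessStructure) (T : Finset B.Point) : Prop :=
  T.card = 3 ∧ ∃ x y z, (T : Set B.Point) = {x, y, z} ∧ B.between x y z

/-- The set of triangles, i.e. of non-collinear (unordered) triples of points. -/
def triangles (B : BetweennessStructure) : Set (Finset B.Point) :=
  {T | T.card = 3 ∧ ¬ B.IsCollinearTriple T}

/-- The co-size: the number of triangles. -/
noncomputable def coSize (B : BetweennessStructure) : ℕ := B.triangles.ncard

/-- The almost-metrizable betweenness structures of order `n` and co-size `m`. -/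
def ofOrderCoSize (n m : ℤ) : Set BetweennessStructure :=
  {B | B.AlmostMetrizable ∧ (B.order : ℤ) = n ∧ (B.coSize : ℤ) = m}

/-- The integers with `⊥ = -∞` and `⊤ = ∞`. -/
abbrev ExtInt : Type := WithBot (WithTop ℤ)

/-- The inclusion of the integers into the extended integers. -/
def toExt (a : ℤ) : ExtInt := ((a : WithTop ℤ) : WithBot (WithTop ℤ))

open Classical in
/-- The maximum of a set of integers: `∞` if the set is not bounded above, and `-∞` if it is
empty. -/
noncomputable def extMax (S : Set ℤ) : ExtInt :=
  if BddAbove S then (if S = ∅ then ⊥ else toExt (sSup S)) else ⊤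

theorem extMax_eq_top_iff (S : Set ℤ) : extMax S = ⊤ ↔ ¬ BddAbove S := by
  have h (a : ℤ) : toExt a ≠ ⊤ := by
    intro h
    exact WithTop.coe_ne_top (WithBot.coe_injective h)
  unfold extMax
  split_ifs with h1 h2
  · simp [h1]
  · simp [h, h1]
  · simp [h1]

theorem extMax_eq_toExt_iff (S : Set ℤ) (a : ℤ) : extMax S = toExt a ↔ IsGreatest S a := by
  have hinj {a b : ℤ} (h : toExt a = toExt b) : a = b :=
    WithTop.coe_injective (WithBot.coe_injective h)
  constructor
  · intro h
    unfold extMax at h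
    split_ifs at h with h1 h2
    · exact absurd h.symm WithBot.coe_ne_bot
    · rw [← hinj h]
      exact ⟨Int.csSup_mem (Set.nonempty_iff_ne_empty.mpr h2) h1, fun x hx => le_csSup h1 hx⟩
    · exact absurd (WithBot.coe_injective h).symm WithTop.coe_ne_top
  · intro h
    have h1 : BddAbove S := ⟨a, h.2⟩
    have h2 : S ≠ ∅ := Set.nonempty_iff_ne_empty.mp ⟨a, h.1⟩
    simp [extMax, h1, h2, h.csSup_eq]

/-- The largest integer `n` for which some structure of order `n` has co-size `k * n - c`. -/
noncomputable def gamma (k c : ℤ) : ExtInt :=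
  extMax {n : ℤ | (ofOrderCoSize n (k * n - c)).Nonempty}

/-- The largest integer `n` for which no structure of order `n` has co-size `k * n - c`. -/
noncomputable def sigma (k c : ℤ) : ExtInt :=
  extMax {n : ℤ | ofOrderCoSize n (k * n - c) = ∅}

/-- `t` is the smallest integer `c` with `gamma k c = ∞`. -/
def IsThetaMin (k t : ℤ) : Prop := IsLeast {c : ℤ | gamma k c = ⊤} t

/-- `t` is the largest integer `c` with `gamma k c = ∞`. -/
def IsThetaMax (k t : ℤ) : Prop := IsGreatest {c : ℤ | gamma k c = ⊤} t

end BetweennessStructure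

/-! Let `n` be the order and `m` the number of triangles. Everything follows from gaps in the
possible values of `m` (`coSize_gaps`): `m = 0` or `m ≥ n - 4`, and for `n ≥ 10` also `m ≤ n - 2` or
`m ≥ 2n - 10`.

Betweenness enters the gaps only through two facts about six points: they never span exactly one
triangle, nor exactly two triangles meeting in one point. The rest is about systems of triples with
these properties (`SparseTriples`). In a minimal counterexample to `m ≥ n - 4`, deleting a point
outside a fixed triple would destroy no triple, so there is only that triple, and `n = 6`.

For the second gap, averaging gives five points spanning no triple when `m < 2n - 10`. Let `I` be a
largest set spanning no triple. By the first gap each point outside `I` makes at least `|I| - 3`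
triples with `I`, so `(n - |I|)(|I| - 3) ≤ m`, which leaves at most one point `x` outside. All
triples then contain `x`: either they share a second point and `m ≤ n - 2`, or `m ≥ 2n - 10`
(`star_dichotomy`).

The values `0`, `n - 2`, `n - 3`, `n - 4` and `2n - 10` are realized by integer points on a line,
some of them doubled. -/

/-! ### Betweenness among at most six points -/

section
variable {α : Type*} {β : α → α → α → Prop}

/-- The laws of a betweenness relation that are used for pairwise distinct points. -/
structure BetweennessLaws (β : α → α → α → Prop) : Prop where
  symm : ∀ x y z, β x y z → β z y x
  antisymm : ∀ x y z, β x y z → β y x z → x = y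
  four : ∀ x y z w, β x y z → β x w y → β x w z ∧ β w y z

/-- One of the three points is between the other two. -/
def ColTriple (β : α → α → α → Prop) (x y z : α) : Prop := β x y z ∨ β y z x ∨ β z x y

/-- `a, d, b, c` is a four-cycle in which `d` and `c` are opposite. -/
def IsApex (β : α → α → α → Prop) (a b c d : α) : Prop := β a d b ∧ β c a d ∧ β c b d

/-- `d` is between any two of `a, b, c`. -/
def IsMedian (β : α → α → α → Prop) (a b c d : α) : Prop := β a d b ∧ β a d c ∧ β b d c

/-- Count the sides of the triangle that have `d` in the middle. Three sides give a median, one side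
a four-cycle; with none or two, `four` would make `a, b, c` collinear. -/
theorem isMedian_or_isApex {a b c d : α} (h : BetweennessLaws β) (hab : a ≠ b) (hac : a ≠ c)
    (hbc : b ≠ c) (hda : d ≠ a) (hdb : d ≠ b)
   (hdc : d ≠ c) (hn : ¬ ColTriple β a b c) (h1 : ColTriple β a b d) (h2 : ColTriple β a c d)
   (h3 : ColTriple β b c d) :
   IsMedian β a b c d ∨ IsApex β a b c d ∨ IsApex β b c a d ∨ IsApex β a c b d := by
  obtain ⟨s, t, f⟩ := h
  unfold ColTriple at *
  unfold IsMedian IsApex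
  grind

/-- The main tool: only a four-cycle opposite to the vertex `a` can keep `a` from separating two
outside points. The pairs of shapes allowed by `isMedian_or_isApex` are checked one by one. -/
theorem between_or_isApex {a b c d e : α} (h : BetweennessLaws β) (hda : d ≠ a) (hdb : d ≠ b)
    (hdc : d ≠ c) (hea : e ≠ a) (heb : e ≠ b) (hec : e ≠ c) (hde : d ≠ e) (hab : a ≠ b)
    (hac : a ≠ c) (hbc : b ≠ c) (hn : ¬ ColTriple β a b c)
    (d1 : ColTriple β a b d) (d2 : ColTriple β a c d) (d3 : ColTriple β b c d)
    (e1 : ColTriple β a b e) (e2 : ColTriple β a c e) (e3 : ColTriple β b c e)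
    (h1 : ColTriple β d e a) (h2 : ColTriple β d e b) (h3 : ColTriple β d e c) :
    β d a e ∨ IsApex β b c a d ∨ IsApex β b c a e := by
  have td := isMedian_or_isApex h hab hac hbc hda hdb hdc hn d1 d2 d3
  have te := isMedian_or_isApex h hab hac hbc hea heb hec hn e1 e2 e3
  obtain ⟨s, t, f⟩ := h
  unfold ColTriple IsMedian IsApex at *
  rcases td with td | td | td | td <;> rcases te with te | te | te | te <;> grind

theorem not_colTriple_of_common_middle {a b d e : α} (h : BetweennessLaws β) (hda : d ≠ a) (hea : e ≠ a)
    (hba : b ≠ a) (hdb : d ≠ b) (heb : e ≠ b) (hde : d ≠ e)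
  (h1 : β d a e) (h2 : β d a b) (h3 : β e a b) : ¬ ColTriple β d e b := by
  obtain ⟨s, t, f⟩ := h
  unfold ColTriple
  grind

theorem ColTriple.swap {a b c : α} (h : BetweennessLaws β)
    (hc : ColTriple β a b c) : ColTriple β b a c := by
  unfold ColTriple at *
  rcases hc with hc | hc | hc <;> have := h.symm _ _ _ hc <;> tauto

theorem ColTriple.rot {a b c : α} (hc : ColTriple β a b c) : ColTriple β b c a := by
  unfold ColTriple at *; tauto

theorem ColTriple.swap' {a b c : α} (h : BetweennessLaws β) (hc : ColTriple β a b c) : ColTriple β a c b :=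
  (hc.swap h).rot

/-- Two opposite points for different vertices fit together as the path `a, d, b, e, c` in a
hexagon. -/
theorem between_of_isApex {a b c d e : α} (h : BetweennessLaws β) (hda : d ≠ a) (hdb : d ≠ b) (hdc : d ≠ c)
    (h3 : ColTriple β d e c) (hd : IsApex β a b c d) (he : IsApex β b c a e) :
    β a d e ∧ β d b e ∧ β c e d := by
  obtain ⟨s, t, f⟩ := h
  unfold ColTriple IsApex at *
  grind

/-- Alternate vertices of the hexagon `b, d, c, e, a, f`. If `e` were between `d` and `f`, then `c`,
being between `d` and `e`, would be between `d` and `f`, whereas `d` is between `c` and `f`. -/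
theorem not_colTriple_of_isApex_cycle {a b c d e f : α} (h : BetweennessLaws β)
    (hdc : d ≠ c) (hea : e ≠ a) (hfb : f ≠ b)
    (h1 : β b d e ∧ β d c e ∧ β a e d) (h2 : β c e f ∧ β e a f ∧ β b f e)
    (h3 : β a f d ∧ β f b d ∧ β c d f) : ¬ ColTriple β d e f := by
  obtain ⟨s, t, f⟩ := h
  unfold ColTriple
  grind

theorem between_of_common_middle {c d x g : α} (h : BetweennessLaws β) (hxg : x ≠ g)
    (h1 : β c x g) (h2 : β d x g) (h3 : ColTriple β c d g) : β c d x ∨ β d c x := by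
  obtain ⟨s, t, f⟩ := h
  unfold ColTriple at *
  grind

theorem not_two_triangles_of_not_isApex {x a b c d g : α} (h : BetweennessLaws β) (hab : a ≠ b)
    (hac : a ≠ c) (hbc : b ≠ c)
   (hda : d ≠ a) (hdb : d ≠ b) (hdc : d ≠ c) (hga : g ≠ a) (hgb : g ≠ b) (hgc : g ≠ c) (hgd : g ≠ d)
   (hxa : x ≠ a) (hxb : x ≠ b) (hxc : x ≠ c) (hxd : x ≠ d) (hxg : x ≠ g)
   (hn : ¬ ColTriple β x a b) (hn' : ¬ ColTriple β x c d)
   (c1 : ColTriple β x a c) (c2 : ColTriple β x b c) (c3 : ColTriple β a b c)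
   (d1 : ColTriple β x a d) (d2 : ColTriple β x b d) (d3 : ColTriple β a b d)
   (g1 : ColTriple β x a g) (g2 : ColTriple β x b g) (g3 : ColTriple β a b g)
   (cd3 : ColTriple β c d g)
   (cg1 : ColTriple β c g x) (cg2 : ColTriple β c g a) (cg3 : ColTriple β c g b)
   (dg1 : ColTriple β d g x) (dg2 : ColTriple β d g a) (dg3 : ColTriple β d g b)
   (hc : ¬ IsApex β a b x c) : False := by
  have td := isMedian_or_isApex h hxa hxb hab hxd.symm hda hdb hn d1 d2 d3
  have te := isMedian_or_isApex h hxa hxb hab hxc.symm hac.symm hbc.symm hn c1 c2 c3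
  -- Some side at `x` has both `c` and `d` in its interior.
  have hcd : ((β x c a ∧ β x d a) ∨ (β x c b ∧ β x d b)) ∧ ¬ IsApex β a b x d := by
    obtain ⟨s, t, f⟩ := h
    unfold ColTriple IsApex IsMedian at *
    rcases td with td | td | td | td <;> rcases te with te | te | te | te <;> grind
  clear td te
  obtain ⟨hcd, hd⟩ := hcd
  have p1 : β c x g ∨ IsApex β a b x c ∨ IsApex β a b x g :=
    between_or_isApex h hxc.symm hac.symm hbc.symm hxg.symm hga hgb hgc.symm hxa hxb hab hn c1 c2 c3 g1 g2 g3 cg1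
        cg2 cg3
  have p2 : β d x g ∨ IsApex β a b x d ∨ IsApex β a b x g :=
    between_or_isApex h hxd.symm hda hdb hxg.symm hga hgb hgd.symm hxa hxb hab hn d1 d2 d3 g1 g2 g3 dg1 dg2 dg3
  -- Otherwise `x` separates `g` from both `c` and `d`, which puts `c` and `d` on one ray from `x`
  -- and makes `x, c, d` collinear.
  have hg : IsApex β a b x g := by
    by_contra hg
    have := between_of_common_middle h hxg (by tauto) (by tauto) cd3
    have := h.symm d c x
    unfold ColTriple at hn'
    tauto
  -- Here `c` and `d` lie on one ray from `a` and both lie between `x` and `a`, so again `x, c, d`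
  -- would be collinear. Since `g` is opposite to `x`, it is opposite to neither `a` nor `b`, and
  -- `p3` to `p6` supply the premises.
  have key : ∀ a, g ≠ a → β c a g → β d a g → β x c a → β x d a → False := by
    intro a hga h1 h2 h3 h4
    have := between_of_common_middle h hga.symm h1 h2 cd3
    rcases this with this | this
    · have k := (h.four a c x d (h.symm _ _ _ h3) (h.symm _ _ _ this)).2
      exact hn' (.inl (h.symm _ _ _ k))
    · have k := (h.four a d x c (h.symm _ _ _ h4) (h.symm _ _ _ this)).2
      exact hn' (.inr (.inl k))
  have hn2 : ¬ ColTriple β a x b := fun k => hn (k.swap h)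
  have p3 : β c a g ∨ IsApex β x b a c ∨ IsApex β x b a g :=
    between_or_isApex h hac.symm hxc.symm hbc.symm hga hxg.symm hgb hgc.symm hxa.symm hab hxb hn2
        (c1.swap h) c3 c2 (g1.swap h) g3 g2 cg2 cg1 cg3
  have p4 : β d a g ∨ IsApex β x b a d ∨ IsApex β x b a g :=
    between_or_isApex h hda hxd.symm hdb hga hxg.symm hgb hgd.symm hxa.symm hab hxb hn2 (d1.swap h) d3 d2
        (g1.swap h) g3 g2 dg2 dg1 dg3
  have hn3 : ¬ ColTriple β b x a := fun k => hn k.rot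
  have p5 : β c b g ∨ IsApex β x a b c ∨ IsApex β x a b g :=
    between_or_isApex h hbc.symm hxc.symm hac.symm hgb hxg.symm hga hgc.symm hxb.symm hab.symm hxa hn3 (c2.swap h)
        (c3.swap h) c1 (g2.swap h) (g3.swap h) g1 cg3 cg1 cg2
  have p6 : β d b g ∨ IsApex β x a b d ∨ IsApex β x a b g :=
    between_or_isApex h hdb hxd.symm hda hgb hxg.symm hga hgd.symm hxb.symm hab.symm hxa hn3 (d2.swap h)
        (d3.swap h) d1 (g2.swap h) (g3.swap h) g1 dg3 dg1 dg2
  have ka := key a hga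
  have kb := key b hgb
  obtain ⟨s, t, f⟩ := h
  unfold IsApex at *
  grind

/-- Six points do not span exactly two triangles `x, a, b` and `x, c, d`. -/
theorem not_two_triangles_sharing_point {x a b c d g : α} (h : BetweennessLaws β) (hab : a ≠ b)
    (hac : a ≠ c) (hbc : b ≠ c)
   (hda : d ≠ a) (hdb : d ≠ b) (hdc : d ≠ c) (hga : g ≠ a) (hgb : g ≠ b) (hgc : g ≠ c) (hgd : g ≠ d)
   (hxa : x ≠ a) (hxb : x ≠ b) (hxc : x ≠ c) (hxd : x ≠ d) (hxg : x ≠ g)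
   (hn : ¬ ColTriple β x a b) (hn' : ¬ ColTriple β x c d)
   (c1 : ColTriple β x a c) (c2 : ColTriple β x b c) (c3 : ColTriple β a b c)
   (d1 : ColTriple β x a d) (d2 : ColTriple β x b d) (d3 : ColTriple β a b d)
   (g1 : ColTriple β x a g) (g2 : ColTriple β x b g) (g3 : ColTriple β a b g)
   (cd1 : ColTriple β c d a) (cd2 : ColTriple β c d b) (cd3 : ColTriple β c d g)
   (cg1 : ColTriple β c g x) (cg2 : ColTriple β c g a) (cg3 : ColTriple β c g b)
   (dg1 : ColTriple β d g x) (dg2 : ColTriple β d g a) (dg3 : ColTriple β d g b) : False := by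
  by_cases hc : IsApex β a b x c
  -- The two triangles can be exchanged: `c` opposite to `x` puts `a` between `x` and `c`, while `a`
  -- opposite to `x` would put `c` between `x` and `a`.
  · have ha : ¬ IsApex β c d x a := by
      obtain ⟨s, t, f⟩ := h
      unfold IsApex ColTriple at *
      grind
    exact not_two_triangles_of_not_isApex h hdc.symm hac.symm hda hbc hdb.symm hab.symm hgc hgd hga hgb
      hxc hxd hxa hxb hxg hn' hn
      (c1.swap' h) (d1.swap' h) cd1 (c2.swap' h) (d2.swap' h) cd2 cg1.rot.rot dg1.rot.rot cd3 g3
      g1.rot (cg2.rot.rot.swap' h) (dg2.rot.rot.swap' h) g2.rot (cg3.rot.rot.swap' h)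
      (dg3.rot.rot.swap' h) ha
  · exact not_two_triangles_of_not_isApex h hab hac hbc hda hdb hdc hga hgb hgc hgd hxa hxb hxc hxd hxg
      hn hn' c1 c2 c3 d1 d2 d3 g1 g2 g3
      cd3 cg1 cg2 cg3 dg1 dg2 dg3 hc

/-- Six points `a, b, c, d, e, f` do not span `a, b, c` as their only triangle. The predicate `O` stands for
being one of `d, e, f`, and `Q` for being two of them. -/
theorem not_unique_triangle {a b c d e f : α} (h : BetweennessLaws β) (hab : a ≠ b) (hac : a ≠ c)
    (hbc : b ≠ c) (hn : ¬ ColTriple β a b c)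
    {O : α → Prop} {Q : α → α → Prop}
    (hO : ∀ p, O p → (p ≠ a ∧ p ≠ b ∧ p ≠ c) ∧ ColTriple β a b p ∧ ColTriple β a c p ∧ ColTriple β b c p)
    (hQ : ∀ p q, Q p q → p ≠ q ∧ ColTriple β p q a ∧ ColTriple β p q b ∧ ColTriple β p q c)
    (hQs : ∀ p q, Q p q → Q q p)
    (hd : O d) (he : O e) (hf : O f) (hde : Q d e) (hdf : Q d f) (hef : Q e f)
    (hdef : ColTriple β d e f) : False := by
  have hn2 : ¬ ColTriple β b a c := fun k => hn (k.swap h)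
  have hn3 : ¬ ColTriple β c a b := fun k => hn k.rot
  have pa : ∀ p q, O p → O q → Q p q → β p a q ∨ IsApex β b c a p ∨ IsApex β b c a q := by
    intro p q hp hq hpq
    obtain ⟨⟨_, _, _⟩, _, _, _⟩ := hO p hp
    obtain ⟨⟨_, _, _⟩, _, _, _⟩ := hO q hq
    obtain ⟨_, _, _, _⟩ := hQ p q hpq
    apply between_or_isApex h (a := a) (b := b) (c := c) <;> assumption
  have pb : ∀ p q, O p → O q → Q p q → β p b q ∨ IsApex β a c b p ∨ IsApex β a c b q := by
    intro p q hp hq hpq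
    obtain ⟨⟨_, _, _⟩, h1, _, _⟩ := hO p hp
    obtain ⟨⟨_, _, _⟩, h2, _, _⟩ := hO q hq
    obtain ⟨_, _, _, _⟩ := hQ p q hpq
    replace h1 := h1.swap h
    replace h2 := h2.swap h
    have := hab.symm
    apply between_or_isApex h (a := b) (b := a) (c := c) <;> assumption
  have pc : ∀ p q, O p → O q → Q p q → β p c q ∨ IsApex β a b c p ∨ IsApex β a b c q := by
    intro p q hp hq hpq
    obtain ⟨⟨_, _, _⟩, _, h3, h1⟩ := hO p hp
    obtain ⟨⟨_, _, _⟩, _, h4, h2⟩ := hO q hq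
    obtain ⟨_, _, _, _⟩ := hQ p q hpq
    replace h1 := h1.swap h
    replace h2 := h2.swap h
    replace h3 := h3.swap h
    replace h4 := h4.swap h
    have := hbc.symm
    have := hac.symm
    apply between_or_isApex h (a := c) (b := a) (c := b) <;> assumption
  -- No vertex separates all pairs of `d, e, f`, as these are collinear. Hence each vertex has an
  -- opposite point among them.
  have hmid : ∀ z, d ≠ z → e ≠ z → f ≠ z → β d z e → β d z f → β e z f → False := fun z h1 h2 h3 k1 k2 k3 =>
    not_colTriple_of_common_middle h h1 h2 h3 (hQ _ _ hdf).1 (hQ _ _ hef).1 (hQ _ _ hde).1 k1 k2 k3 hdef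
  have comb : ∀ {A B C p q r : Prop}, (A → B → C → False) → (A ∨ p ∨ q) → (B ∨ p ∨ r) → (C ∨ q ∨ r) →
      p ∨ q ∨ r := by
    intros
    tauto
  have ea : IsApex β b c a d ∨ IsApex β b c a e ∨ IsApex β b c a f := by
    exact comb (hmid a (hO d hd).1.1 (hO e he).1.1 (hO f hf).1.1)
      (pa d e hd he hde) (pa d f hd hf hdf) (pa e f he hf hef)
  have eb : IsApex β a c b d ∨ IsApex β a c b e ∨ IsApex β a c b f := by
    exact comb (hmid b (hO d hd).1.2.1 (hO e he).1.2.1 (hO f hf).1.2.1)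
      (pb d e hd he hde) (pb d f hd hf hdf) (pb e f he hf hef)
  have ec : IsApex β a b c d ∨ IsApex β a b c e ∨ IsApex β a b c f := by
    exact comb (hmid c (hO d hd).1.2.2 (hO e he).1.2.2 (hO f hf).1.2.2)
      (pc d e hd he hde) (pc d f hd hf hdf) (pc e f he hf hef)
  have xx : ∀ p u v, p ≠ v → β u p v → ¬ β u v p := fun p u v hp h1 h2 =>
    hp (h.antisymm _ _ _ (h.symm _ _ _ h2) (h.symm _ _ _ h1))
  have xab : ∀ p, O p → ¬ (IsApex β b c a p ∧ IsApex β a c b p) := by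
    rintro p hp ⟨⟨h1, -, -⟩, -, -, h2⟩
    exact xx _ _ _ (hO p hp).1.2.2 h1 h2
  have xac : ∀ p, O p → ¬ (IsApex β b c a p ∧ IsApex β a b c p) := by
    rintro p hp ⟨⟨h1, -, -⟩, -, -, h2⟩
    exact xx _ _ _ (hO p hp).1.2.1 (h.symm _ _ _ h1) h2
  have xbc : ∀ p, O p → ¬ (IsApex β a c b p ∧ IsApex β a b c p) := by
    rintro p hp ⟨⟨h1, -, -⟩, -, h2, -⟩
    exact xx _ _ _ (hO p hp).1.1 (h.symm _ _ _ h1) h2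
  -- No point is opposite to two vertices, so the opposite points form a permutation of `d, e, f`
  -- and close up a hexagon with `a, b, c`.
  have aa : ∀ p q r, O p → O q → O r → Q p q → Q q r → Q r p → ColTriple β p q r →
      IsApex β b c a p → IsApex β a c b q → IsApex β a b c r → False := by
    intro p q r hp hq hr hpq hqr hrp hc ap aq ar
    obtain ⟨⟨_, _, _⟩, _, _, _⟩ := hO p hp
    obtain ⟨⟨_, _, _⟩, _, _, _⟩ := hO q hq
    obtain ⟨⟨_, _, _⟩, _, _, _⟩ := hO r hr
    obtain ⟨_, _, _, _⟩ := hQ p q hpq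
    obtain ⟨_, _, _, _⟩ := hQ q r hqr
    obtain ⟨_, _, _, _⟩ := hQ r p hrp
    have aq' : IsApex β c a b q := ⟨h.symm _ _ _ aq.1, aq.2.2, aq.2.1⟩
    have h1 : β b p q ∧ β p c q ∧ β a q p := by
      apply between_of_isApex h (a := b) (b := c) (c := a) <;> assumption
    have h2 : β c q r ∧ β q a r ∧ β b r q := by
      apply between_of_isApex h (a := c) (b := a) (c := b) <;> assumption
    have h3 : β a r p ∧ β r b p ∧ β c p r := by
      apply between_of_isApex h (a := a) (b := b) (c := c) <;> assumption
    exact not_colTriple_of_isApex_cycle h (by assumption) (by assumption) (by assumption) h1 h2 h3 hc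
  have s1 := hQs _ _ hde
  have s2 := hQs _ _ hdf
  have s3 := hQs _ _ hef
  rcases ea with ea | ea | ea <;> rcases eb with eb | eb | eb <;>
    first
    | exact xab _ (by assumption) ⟨ea, eb⟩
    | rcases ec with ec | ec | ec <;>
      first
      | exact xac _ (by assumption) ⟨ea, ec⟩
      | exact xbc _ (by assumption) ⟨eb, ec⟩
      | exact aa d e f hd he hf hde hef s2 hdef ea eb ec
      | exact aa d f e hd hf he hdf s3 s1 (hdef.swap' h) ea eb ec
      | exact aa e d f he hd hf s1 hdf s3 (hdef.swap h) ea eb ec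
      | exact aa e f d he hf hd hef s2 hde hdef.rot ea eb ec
      | exact aa f d e hf hd he s2 hde hef hdef.rot.rot ea eb ec
      | exact aa f e d hf he hd s3 s1 hdf (hdef.rot.swap h) ea eb ec
end

/-! ### Systems of triples with the two six-point properties -/

section
variable {α : Type*} [DecidableEq α]

/-- The number of members of `T` inside `S`. -/
def spanCount (T : Finset (Finset α)) (S : Finset α) : ℕ := (T.filter (· ⊆ S)).card

/-- A family of triples in which six points never span exactly one triple, nor exactly two triples
meeting in one point. -/
structure SparseTriples (T : Finset (Finset α)) : Prop where
  card_eq : ∀ t ∈ T, t.card = 3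
  ne_one : ∀ S : Finset α, S.card = 6 → spanCount T S ≠ 1
  ne_two : ∀ S : Finset α, S.card = 6 → ∀ t ∈ T, ∀ u ∈ T, t ⊆ S → u ⊆ S → (t ∩ u).card = 1 →
    spanCount T S ≠ 2

variable {T : Finset (Finset α)} {S : Finset α}

theorem spanCount_mono {R S : Finset α} (h : R ⊆ S) : spanCount T R ≤ spanCount T S :=
  Finset.card_le_card (Finset.monotone_filter_right _ fun _ _ ht => ht.trans h)

theorem spanCount_pos : spanCount T S ≠ 0 ↔ ∃ t ∈ T, t ⊆ S := by
  simp [spanCount, Finset.filter_eq_empty_iff]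

/-- The number of members of `T` inside `S` that contain `x`. -/
def degreeIn (T : Finset (Finset α)) (S : Finset α) (x : α) : ℕ :=
  (T.filter fun t => t ⊆ S ∧ x ∈ t).card

theorem spanCount_erase_add (x : α) :
    spanCount T (S.erase x) + degreeIn T S x = spanCount T S := by
  unfold spanCount degreeIn
  rw [← Finset.card_union_of_disjoint]
  · congr 1
    ext t
    simp only [Finset.mem_union, Finset.mem_filter, Finset.subset_erase]
    tauto
  · rw [Finset.disjoint_left]
    simp only [Finset.mem_filter, Finset.subset_erase]
    tauto

theorem sum_degreeIn (hT : ∀ t ∈ T, t.card = 3) :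
    ∑ x ∈ S, degreeIn T S x = 3 * spanCount T S := by
  have := Finset.sum_card_bipartiteAbove_eq_sum_card_bipartiteBelow
    (s := S) (t := T.filter (· ⊆ S)) (fun x t => x ∈ t)
  simp only [Finset.bipartiteAbove, Finset.bipartiteBelow, Finset.filter_filter] at this
  unfold degreeIn spanCount
  rw [this, mul_comm, Finset.card_eq_sum_ones, Finset.sum_mul]
  refine Finset.sum_congr rfl fun t ht => ?_
  rw [Finset.mem_filter] at ht
  rw [Finset.filter_mem_eq_inter, Finset.inter_eq_right.2 ht.2, hT t ht.1, one_mul]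

/-- Averaging: if `S` spans `m + j + 1` triples and every deletion leaves more than `m`, all degrees
are at most `j`, so `3(m + j + 1) ≤ |S| j`. -/
theorem exists_spanCount_erase_le (hT : ∀ t ∈ T, t.card = 3) {m d : ℕ} (hS : S.Nonempty)
    (h : spanCount T S ≤ m + d) (hd : ∀ j, j < d → S.card * j < 3 * (m + j + 1)) :
    ∃ x ∈ S, spanCount T (S.erase x) ≤ m := by
  by_contra! hc
  obtain ⟨x, hx⟩ := hS
  have h1 := hc x hx
  have h2 := spanCount_mono (T := T) (Finset.erase_subset x S)
  obtain ⟨j, hj⟩ : ∃ j, spanCount T S = m + j + 1 := ⟨spanCount T S - m - 1, by omega⟩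
  have h3 := Finset.sum_le_card_nsmul S (degreeIn T S) j fun y hy => by
    have := hc y hy
    have := spanCount_erase_add (T := T) (S := S) y
    omega
  rw [sum_degreeIn hT, hj, smul_eq_mul] at h3
  have := hd j (by omega)
  omega

/-- Points that span a triple span at least their number minus four. -/
theorem SparseTriples.card_le_spanCount_add (hT : SparseTriples T) :
    spanCount T S ≠ 0 → S.card ≤ spanCount T S + 4 := by
  induction hn : S.card using Nat.strong_induction_on generalizing S with
  | _ n ih =>
    intro h0
    by_contra! hlt
    have h1 : n ≠ 6 := by
      rintro rfl
      have := hT.ne_one S hn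
      omega
    obtain ⟨t, ht, htS⟩ := spanCount_pos.1 h0
    -- The triple `t` survives the deletion of `x`, so the induction hypothesis applies; it leaves
    -- no room for losing a triple.
    have hdeg : ∀ x ∈ S, x ∉ t → spanCount T (S.erase x) = spanCount T S ∧ n ≤ spanCount T S + 5 := by
      intro x hx hxt
      have hc := Finset.card_erase_of_mem hx
      have := ih (n - 1) (by omega) (S := S.erase x) (by omega)
        (spanCount_pos.2 ⟨t, ht, Finset.subset_erase.2 ⟨htS, hxt⟩⟩)
      have := spanCount_mono (T := T) (Finset.erase_subset x S)
      omega
    have hone : spanCount T S = 1 := by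
      unfold spanCount
      rw [Finset.card_eq_one]
      refine ⟨t, ?_⟩
      ext u
      simp only [Finset.mem_filter, Finset.mem_singleton]
      constructor
      · rintro ⟨hu, huS⟩
        refine Finset.eq_of_subset_of_card_le (fun x hx => ?_) (by rw [hT.card_eq u hu, hT.card_eq t ht])
        by_contra hxt
        have e1 := (hdeg x (huS hx) hxt).1
        have e2 := spanCount_erase_add (T := T) (S := S) x
        have : 0 < degreeIn T S x := Finset.card_pos.2 ⟨u, by simp [hu, huS, hx]⟩
        omega
      · rintro rfl
        exact ⟨ht, htS⟩
    obtain ⟨x, hx, hxt⟩ := Finset.exists_mem_notMem_of_card_lt_card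
      (s := t) (t := S) (by rw [hT.card_eq t ht]; omega)
    have := (hdeg x hx hxt).2
    omega

theorem exists_five_of_spanCount_le (hT : ∀ t ∈ T, t.card = 3) (h10 : 10 ≤ S.card)
    (h : spanCount T S + 11 ≤ 2 * S.card) : ∃ R ⊆ S, R.card = 5 ∧ spanCount T R = 0 := by
  have step : ∀ (n m d : ℕ), (∀ R : Finset α, R.card = n → spanCount T R ≤ m →
      ∃ Q ⊆ R, Q.card = 5 ∧ spanCount T Q = 0) → (∀ j, j < d → (n + 1) * j < 3 * (m + j + 1)) →
      ∀ R : Finset α, R.card = n + 1 → spanCount T R ≤ m + d →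
      ∃ Q ⊆ R, Q.card = 5 ∧ spanCount T Q = 0 := by
    intro n m d ih hd R hR hm
    obtain ⟨x, hx, hxm⟩ := exists_spanCount_erase_le hT (Finset.card_pos.1 (by omega)) hm (by rwa [hR])
    obtain ⟨Q, hQ, h⟩ := ih (R.erase x) (by rw [Finset.card_erase_of_mem hx]; omega) hxm
    exact ⟨Q, hQ.trans (Finset.erase_subset _ _), h⟩
  -- Averaging allows `1, 3, 6, 9, 9` triples on `6, 7, 8, 9, 10` points, and from there two more
  -- for each further point.
  have h5 := step 5 0 1 (fun R hR h0 => ⟨R, subset_rfl, hR, by omega⟩)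
      (by intro j hj; interval_cases j; simp)
  have h7 := step 6 1 2 h5 (by intro j hj; interval_cases j <;> simp)
  have h8 := step 7 3 3 h7 (by intro j hj; interval_cases j <;> simp)
  have h9 := step 8 6 3 h8 (by intro j hj; interval_cases j <;> simp)
  have h10' := step 9 9 0 h9 (by simp)
  have main : ∀ k, ∀ R : Finset α, R.card = k + 10 → spanCount T R ≤ 2 * k + 9 →
      ∃ Q ⊆ R, Q.card = 5 ∧ spanCount T Q = 0 := by
    intro k
    induction k with
    | zero => exact h10'
    | succ k ih =>
      intro R hR hm
      refine step (k + 10) (2 * k + 9) 2 ih ?_ R (by omega) (by omega)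
      intro j hj
      interval_cases j <;> omega
  exact main (S.card - 10) S (by omega) (by omega)

/-- Adding `x` to `I` creates at least `|I| + 1 - 4` triples. Each contains `x` and otherwise only
points of `I`, so different `x` yield different triples. -/
theorem SparseTriples.card_mul_card_le {I : Finset α} (hT : SparseTriples T) (hI : I ⊆ S)
    (hmax : ∀ x ∈ S, x ∉ I → spanCount T (insert x I) ≠ 0) (h0 : spanCount T I = 0) :
    (S \ I).card * (I.card - 3) ≤ spanCount T S := by
  have hd : ∀ x ∈ S \ I, I.card - 3 ≤ (T.filter (· ⊆ insert x I)).card := by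
    intro x hx
    rw [Finset.mem_sdiff] at hx
    have := hT.card_le_spanCount_add (hmax x hx.1 hx.2)
    rw [Finset.card_insert_of_notMem hx.2] at this
    unfold spanCount at this
    omega
  have h1 := Finset.card_nsmul_le_sum _ _ _ hd
  rw [← Finset.card_biUnion] at h1
  · refine h1.trans (Finset.card_le_card ?_)
    intro t
    simp only [Finset.mem_biUnion, Finset.mem_filter, Finset.mem_sdiff]
    rintro ⟨x, ⟨hx, -⟩, ht, hts⟩
    exact ⟨ht, hts.trans (Finset.insert_subset hx hI)⟩
  · intro x hx y hy hxy
    rw [Function.onFun, Finset.disjoint_left]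
    intro t ht ht'
    rw [Finset.mem_filter] at ht ht'
    refine spanCount_pos.2 ⟨t, ht.1, fun z hz => ?_⟩ h0
    have a := ht.2 hz
    have b := ht'.2 hz
    rw [Finset.mem_insert] at a b
    rcases a with rfl | a
    · rcases b with rfl | b
      · exact absurd rfl hxy
      · exact b
    · exact a

/-- Induction by deleting a point of degree at least two, which pays for the two units lost on the
left. If there is none, the triples meet only in `x`, and two of them with a sixth point violate
`ne_two`. -/
theorem SparseTriples.star_dichotomy {x : α} (hT : SparseTriples T)
    (hx : ∀ t ∈ T, t ⊆ S → x ∈ t) (hns : ∀ p, p ≠ x → ∃ t ∈ T, t ⊆ S ∧ p ∉ t) :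
    2 * S.card ≤ spanCount T S + 10 := by
  induction hn : S.card generalizing S with
  | zero => omega
  | succ n ih =>
    by_cases h2 : ∃ p ∈ S, p ≠ x ∧ 2 ≤ degreeIn T S p
    · obtain ⟨p, hp, hpx, hdeg⟩ := h2
      have hpc := Finset.card_erase_of_mem hp
      have hadd := spanCount_erase_add (T := T) (S := S) p
      by_cases hp' : ∀ q, q ≠ x → ∃ t ∈ T, t ⊆ S.erase p ∧ q ∉ t
      · have := ih (fun t ht hts => hx t ht (hts.trans (Finset.erase_subset _ _))) hp' (by omega)
        omega
      -- All triples avoiding `p` contain `q`. So those avoiding `p` and those avoiding `q` are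
      -- disjoint families, each with at least `|S| - 5` members by the first gap.
      · push Not at hp'
        obtain ⟨q, hqx, hq⟩ := hp'
        obtain ⟨t, ht, hts, hpt⟩ := hns p hpx
        have htp := Finset.subset_erase.2 ⟨hts, hpt⟩
        have hqS : q ∈ S := hts (hq t ht htp)
        obtain ⟨u, hu, hus, hqu⟩ := hns q hqx
        have l1 := hT.card_le_spanCount_add (spanCount_pos.2 ⟨t, ht, htp⟩)
        have l2 := hT.card_le_spanCount_add (spanCount_pos.2 ⟨u, hu, Finset.subset_erase.2 ⟨hus, hqu⟩⟩)
        have hqc := Finset.card_erase_of_mem hqS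
        have : spanCount T (S.erase q) ≤ degreeIn T S p := by
          refine Finset.card_le_card fun v hv => ?_
          simp only [Finset.mem_filter, Finset.subset_erase] at hv ⊢
          refine ⟨hv.1, hv.2.1, ?_⟩
          by_contra hpv
          exact hv.2.2 (hq v hv.1 (Finset.subset_erase.2 ⟨hv.2.1, hpv⟩))
        omega
    · push Not at h2
      by_contra! hlt
      have huniq : ∀ t ∈ T, ∀ u ∈ T, t ⊆ S → u ⊆ S → ∀ p, p ≠ x → p ∈ t → p ∈ u → t = u := by
        intro t ht u hu hts hus p hpx hpt hpu
        have := h2 p (hts hpt) hpx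
        exact Finset.card_le_one.1 (Nat.lt_succ_iff.1 this) t (by simp [ht, hts, hpt]) u
            (by simp [hu, hus, hpu])
      obtain ⟨y, hy⟩ : ∃ y, y ∈ S.erase x := by
        apply Finset.card_pos.1
        have := Finset.pred_card_le_card_erase (s := S) (a := x)
        omega
      obtain ⟨t, ht, hts, -⟩ := hns y (Finset.ne_of_mem_erase hy)
      obtain ⟨p, hpt, hpx⟩ : ∃ p ∈ t, p ≠ x :=
        Finset.exists_mem_ne (by rw [hT.card_eq t ht]; norm_num) x
      obtain ⟨u, hu, hus, hpu⟩ := hns p hpx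
      have htu : t ∩ u = {x} := by
        ext z
        simp only [Finset.mem_inter, Finset.mem_singleton]
        constructor
        · rintro ⟨hz, hz'⟩
          by_contra hzx
          exact hpu (huniq t ht u hu hts hus z hzx hz hz' ▸ hpt)
        · rintro rfl
          exact ⟨hx t ht hts, hx u hu hus⟩
      have hcard : (t ∪ u).card = 5 := by
        have := Finset.card_union_add_card_inter t u
        rw [htu, hT.card_eq t ht, hT.card_eq u hu, Finset.card_singleton] at this
        omega
      obtain ⟨g, hg, hgtu⟩ := Finset.exists_mem_notMem_of_card_lt_card
        (s := t ∪ u) (t := S) (by omega)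
      refine hT.ne_two (insert g (t ∪ u)) (by rw [Finset.card_insert_of_notMem hgtu, hcard]) t ht u hu
        ?_ ?_ (by rw [htu]; simp) ?_
      · exact Finset.subset_union_left.trans (Finset.subset_insert _ _)
      · exact Finset.subset_union_right.trans (Finset.subset_insert _ _)
      · unfold spanCount
        rw [Finset.card_eq_two]
        refine ⟨t, u, fun h => hpu (h ▸ hpt), ?_⟩
        ext v
        simp only [Finset.mem_filter, Finset.mem_insert, Finset.mem_singleton]
        constructor
        · rintro ⟨hv, hvs⟩
          have hvS : v ⊆ S := hvs.trans
            (Finset.insert_subset hg (Finset.union_subset hts hus))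
          -- A triple inside the six points has, besides `x`, a point other than `g`; that point
          -- already determines it as `t` or `u`.
          obtain ⟨z, hzv, hz⟩ : ∃ z ∈ v.erase x, z ≠ g :=
            Finset.exists_mem_ne (by rw [Finset.card_erase_of_mem
            (hx v hv hvS), hT.card_eq v hv]; norm_num) g
          rw [Finset.mem_erase] at hzv
          have := hvs hzv.2
          rw [Finset.mem_insert, Finset.mem_union] at this
          rcases this with h | h | h
          · exact absurd h hz
          · exact .inl (huniq v hv t ht hvS hts z hzv.1 hzv.2 h)
          · exact .inr (huniq v hv u hu hvS hus z hzv.1 hzv.2 h)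
        · rintro (rfl | rfl)
          · exact ⟨ht, Finset.subset_union_left.trans (Finset.subset_insert _ _)⟩
          · exact ⟨hu, Finset.subset_union_right.trans (Finset.subset_insert _ _)⟩

theorem spanCount_le_of_pair {x p : α} (hT : ∀ t ∈ T, t.card = 3) (hpx : p ≠ x)
    (h : ∀ t ∈ T, t ⊆ S → x ∈ t ∧ p ∈ t) : spanCount T S ≤ S.card - 2 := by
  by_cases h0 : spanCount T S = 0
  · omega
  obtain ⟨t, ht, hts⟩ := spanCount_pos.1 h0
  have hpS := hts (h t ht hts).2
  have hxS := hts (h t ht hts).1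
  have hc : ((S.erase x).erase p).card = S.card - 2 := by
    rw [Finset.card_erase_of_mem (by simp [hpx, hpS]), Finset.card_erase_of_mem hxS]
    omega
  rw [← hc]
  refine (Finset.card_le_card (t :=
      ((S.erase x).erase p).image fun z => {x, p, z}) ?_).trans Finset.card_image_le
  intro u hu
  rw [Finset.mem_filter] at hu
  obtain ⟨hu, hus⟩ := hu
  obtain ⟨hxu, hpu⟩ := h u hu hus
  have hc1 : ((u.erase x).erase p).card = 1 := by
    rw [Finset.card_erase_of_mem (by simp [hpx, hpu]), Finset.card_erase_of_mem hxu, hT u hu]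
  obtain ⟨z, hz⟩ := Finset.card_eq_one.1 hc1
  have hzu : z ∈ (u.erase x).erase p := by simp [hz]
  rw [Finset.mem_image]
  refine ⟨z, ?_, ?_⟩
  · simp only [Finset.mem_erase] at hzu ⊢
    exact ⟨hzu.1, hzu.2.1, hus hzu.2.2⟩
  · rw [← hz, Finset.insert_erase (by simp [hpx, hpu]), Finset.insert_erase hxu]

theorem SparseTriples.upper_gap (hT : SparseTriples T) (h10 : 10 ≤ S.card) :
    spanCount T S + 2 ≤ S.card ∨ 2 * S.card ≤ spanCount T S + 10 := by
  by_contra! hc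
  obtain ⟨hlo, hhi⟩ := hc
  obtain ⟨R, hRS, hR, hR0⟩ := exists_five_of_spanCount_le hT.card_eq h10 (by omega)
  obtain ⟨I, hI, hmax⟩ := Finset.exists_max_image (S.powerset.filter fun I => spanCount T I = 0)
    Finset.card ⟨R, by simp [hRS, hR0]⟩
  simp only [Finset.mem_filter, Finset.mem_powerset] at hI hmax
  have hI5 := hmax R ⟨hRS, hR0⟩
  have hmax' : ∀ x ∈ S, x ∉ I → spanCount T (insert x I) ≠ 0 := by
    intro x hx hxI h0
    have := hmax (insert x I) ⟨Finset.insert_subset hx hI.1, h0⟩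
    rw [Finset.card_insert_of_notMem hxI] at this
    omega
  have hmul := hT.card_mul_card_le hI.1 hmax' hI.2
  have hcard := Finset.card_sdiff_add_card_eq_card hI.1
  have hle : (S \ I).card ≤ 1 := by
    by_contra! h2
    -- With `2 + r` points outside and `5 + k` inside, the product is `(2 + r)(2 + k) ≥ 4 + 2k + 2r
    -- = 2|S| - 10`.
    obtain ⟨r, hr⟩ := Nat.exists_eq_add_of_le (show 2 ≤ (S \ I).card from h2)
    obtain ⟨k, hk⟩ := Nat.exists_eq_add_of_le hI5
    rw [hr, hk, hR, show 5 + k - 3 = 2 + k by omega] at hmul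
    have : (2 + r) * (2 + k) = 4 + 2 * k + 2 * r + r * k := by ring
    have := Nat.zero_le (r * k)
    omega
  rcases Nat.le_one_iff_eq_zero_or_eq_one.1 hle with h | h
  · rw [Finset.card_eq_zero, Finset.sdiff_eq_empty_iff_subset] at h
    rw [Finset.Subset.antisymm hI.1 h] at hI
    omega
  · obtain ⟨x, hx⟩ := Finset.card_eq_one.1 h
    have hxt : ∀ t ∈ T, t ⊆ S → x ∈ t := by
      intro t ht hts
      by_contra hxt
      refine spanCount_pos.2 ⟨t, ht, fun z hz => ?_⟩ hI.2
      by_contra hzI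
      have : z ∈ S \ I := Finset.mem_sdiff.2 ⟨hts hz, hzI⟩
      rw [hx, Finset.mem_singleton] at this
      exact hxt (this ▸ hz)
    by_cases hns : ∀ p, p ≠ x → ∃ t ∈ T, t ⊆ S ∧ p ∉ t
    · have := hT.star_dichotomy hxt hns
      omega
    · push Not at hns
      obtain ⟨p, hpx, hp⟩ := hns
      have := spanCount_le_of_pair hT.card_eq hpx fun t ht hts => ⟨hxt t ht hts, hp t ht hts⟩
      omega
end

/-! ### The triangles of a betweenness structure as a sparse system of triples -/

namespace BetweennessStructure

theorem AlmostMetrizable.laws {B : BetweennessStructure}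
    (h : B.AlmostMetrizable) : BetweennessLaws B.between :=
  ⟨h.symm, h.antisymm, h.four_relations⟩

section
variable {B : BetweennessStructure} [DecidableEq B.Point]

theorem mem_triangles_iff (hs : ∀ x y z, B.between x y z → B.between z y x) {a b c : B.Point}
    (hab : a ≠ b) (hac : a ≠ c) (hbc : b ≠ c) :
    ({a, b, c} : Finset B.Point) ∈ B.triangles ↔ ¬ ColTriple B.between a b c := by
  have h3 : ({a, b, c} : Finset B.Point).card = 3 := Finset.card_eq_three.2 ⟨a, b, c, hab, hac, hbc, rfl⟩
  simp only [triangles, Set.mem_ofPred_eq, h3, true_and, IsCollinearTriple, not_iff_not]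
  constructor
  · rintro ⟨x, y, z, hxyz, hb⟩
    have hx : x = a ∨ x = b ∨ x = c := by
      have : x ∈ (({a, b, c} : Finset B.Point) : Set B.Point) := by rw [hxyz]; simp
      simpa using this
    have hy : y = a ∨ y = b ∨ y = c := by
      have : y ∈ (({a, b, c} : Finset B.Point) : Set B.Point) := by rw [hxyz]; simp
      simpa using this
    have hz : z = a ∨ z = b ∨ z = c := by
      have : z ∈ (({a, b, c} : Finset B.Point) : Set B.Point) := by rw [hxyz]; simp
      simpa using this
    have ha : a = x ∨ a = y ∨ a = z := by
      have : a ∈ ({x, y, z} : Set B.Point) := by rw [← hxyz]; simp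
      simpa using this
    have hb' : b = x ∨ b = y ∨ b = z := by
      have : b ∈ ({x, y, z} : Set B.Point) := by rw [← hxyz]; simp
      simpa using this
    have hc : c = x ∨ c = y ∨ c = z := by
      have : c ∈ ({x, y, z} : Set B.Point) := by rw [← hxyz]; simp
      simpa using this
    have := hs _ _ _ hb
    unfold ColTriple
    grind
  · rintro (h | h | h)
    · exact ⟨a, b, c, by simp, h⟩
    · exact ⟨b, c, a, by ext; simp; tauto, h⟩
    · exact ⟨c, a, b, by ext; simp; tauto, h⟩

open Classical in
/-- The triangles as a finset of finsets. -/
noncomputable def triangleFinset (B : BetweennessStructure) [Fintype B.Point] : Finset (Finset B.Point) :=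
  Finset.univ.filter (· ∈ B.triangles)

theorem mem_triangleFinset [Fintype B.Point] {t : Finset B.Point} :
    t ∈ B.triangleFinset ↔ t ∈ B.triangles := by
  simp [triangleFinset]

theorem coSize_eq_spanCount [Fintype B.Point] : B.coSize = spanCount B.triangleFinset Finset.univ := by
  have : B.triangles = B.triangleFinset := by
    ext t
    rw [Finset.mem_coe, mem_triangleFinset]
  rw [coSize, this, Set.ncard_coe_finset, spanCount, Finset.filter_true_of_mem fun t _ =>
  Finset.subset_univ t]

theorem colTriple_of_spanCount [Fintype B.Point] (h : B.AlmostMetrizable) {S : Finset B.Point}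
    {p q r : B.Point} (hp : p ∈ S) (hq : q ∈ S) (hr : r ∈ S) (hpq : p ≠ q) (hpr : p ≠ r) (hqr : q ≠ r)
    (hn : {p, q, r} ∉ B.triangleFinset.filter (· ⊆ S)) : ColTriple B.between p q r := by
  by_contra hc
  refine hn (Finset.mem_filter.2 ⟨mem_triangleFinset.2 ((mem_triangles_iff h.symm hpq hpr hqr).2 hc), ?_⟩)
  intro z
  simp only [Finset.mem_insert, Finset.mem_singleton]
  rintro (rfl | rfl | rfl) <;> assumption

theorem AlmostMetrizable.spanCount_ne_one [Fintype B.Point] (h : B.AlmostMetrizable)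
    {S : Finset B.Point} (hS : S.card = 6) : spanCount B.triangleFinset S ≠ 1 := by
  intro h1
  obtain ⟨t, ht⟩ := Finset.card_eq_one.1 h1
  have htm : t ∈ B.triangleFinset.filter (· ⊆ S) := by simp [ht]
  rw [Finset.mem_filter, mem_triangleFinset] at htm
  obtain ⟨htm, hts⟩ := htm
  obtain ⟨a, b, c, hab, hac, hbc, rfl⟩ := Finset.card_eq_three.1 htm.1
  have hc := Finset.card_sdiff_add_card_eq_card hts
  rw [htm.1, hS] at hc
  obtain ⟨d, e, f, hde, hdf, hef, hdef⟩ := Finset.card_eq_three.1 (Nat.add_right_cancel hc : _ = 3)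
  have hout : ∀ p, p ∈ S \ {a, b, c} ↔ p = d ∨ p = e ∨ p = f := by simp [hdef]
  have key : ∀ p q r, p ∈ S → q ∈ S → r ∈ S → p ≠ q → p ≠ r → q ≠ r →
      (p ∉ ({a, b, c} : Finset B.Point) ∨ q ∉ ({a, b, c} : Finset B.Point) ∨
        r ∉ ({a, b, c} : Finset B.Point)) → ColTriple B.between p q r := by
    intro p q r hp hq hr hpq hpr hqr hmem
    refine colTriple_of_spanCount h hp hq hr hpq hpr hqr ?_
    rw [ht, Finset.mem_singleton]
    intro heq
    rw [← heq] at hmem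
    simp at hmem
  have ha : a ∈ S := hts (by simp)
  have hb : b ∈ S := hts (by simp)
  have hcS : c ∈ S := hts (by simp)
  refine not_unique_triangle h.laws hab hac hbc ((mem_triangles_iff h.symm hab hac hbc).1 htm)
    (O := (· ∈ S \ {a, b, c})) (Q := fun p q => p ≠ q ∧ p ∈ S \ {a, b, c} ∧ q ∈ S \ {a, b, c})
    (d := d) (e := e) (f := f) ?_ ?_ (fun p q hpq => ⟨hpq.1.symm, hpq.2.2, hpq.2.1⟩)
    (by simp [hout]) (by simp [hout]) (by simp [hout]) (by simp [hout, hde]) (by simp [hout, hdf])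
    (by simp [hout, hef]) ?_
  · intro p hp
    rw [Finset.mem_sdiff] at hp
    have hp' := hp.2
    simp only [Finset.mem_insert, Finset.mem_singleton, not_or, ← ne_eq] at hp'
    exact ⟨hp', key _ _ _ ha hb hp.1 hab hp'.1.symm hp'.2.1.symm (.inr (.inr hp.2)),
      key _ _ _ ha hcS hp.1 hac hp'.1.symm hp'.2.2.symm (.inr (.inr hp.2)),
      key _ _ _ hb hcS hp.1 hbc hp'.2.1.symm hp'.2.2.symm (.inr (.inr hp.2))⟩
  · rintro p q ⟨hpq, hp, hq⟩
    rw [Finset.mem_sdiff] at hp hq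
    have hp' := hp.2
    have hq' := hq.2
    simp only [Finset.mem_insert, Finset.mem_singleton, not_or] at hp' hq'
    exact ⟨hpq, key _ _ _ hp.1 hq.1 ha hpq hp'.1 hq'.1 (.inl hp.2),
      key _ _ _ hp.1 hq.1 hb hpq hp'.2.1 hq'.2.1 (.inl hp.2),
      key _ _ _ hp.1 hq.1 hcS hpq hp'.2.2 hq'.2.2 (.inl hp.2)⟩
  · have hd := Finset.mem_sdiff.1 ((hout d).2 (.inl rfl))
    have he := Finset.mem_sdiff.1 ((hout e).2 (.inr (.inl rfl)))
    have hf := Finset.mem_sdiff.1 ((hout f).2 (.inr (.inr rfl)))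
    exact key _ _ _ hd.1 he.1 hf.1 hde hdf hef (.inl hd.2)

theorem AlmostMetrizable.spanCount_ne_two [Fintype B.Point] (h : B.AlmostMetrizable)
    {S t u : Finset B.Point} (hS : S.card = 6) (ht : t ∈ B.triangleFinset) (hu : u ∈ B.triangleFinset)
    (hts : t ⊆ S) (hus : u ⊆ S) (htu : (t ∩ u).card = 1) : spanCount B.triangleFinset S ≠ 2 := by
  intro h2
  obtain ⟨x, hx⟩ := Finset.card_eq_one.1 htu
  have ht3 := (mem_triangleFinset.1 ht).1
  have hu3 := (mem_triangleFinset.1 hu).1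
  have hxtu : x ∈ t ∩ u := by simp [hx]
  rw [Finset.mem_inter] at hxtu
  obtain ⟨a, b, hab, hab'⟩ := Finset.card_eq_two.1
    (show (t.erase x).card = 2 by rw [Finset.card_erase_of_mem hxtu.1, ht3])
  obtain ⟨c, d, hcd, hcd'⟩ := Finset.card_eq_two.1
    (show (u.erase x).card = 2 by rw [Finset.card_erase_of_mem hxtu.2, hu3])
  have hta : ∀ z, z ∈ t ↔ z = x ∨ z = a ∨ z = b := by
    intro z
    rw [← Finset.insert_erase hxtu.1, hab']
    simp
  have hua : ∀ z, z ∈ u ↔ z = x ∨ z = c ∨ z = d := by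
    intro z
    rw [← Finset.insert_erase hxtu.2, hcd']
    simp
  have ht' : t = {x, a, b} := by ext z; simp [hta]
  have hu' : u = {x, c, d} := by ext z; simp [hua]
  have hxe : ∀ z ∈ t.erase x, x ≠ z := fun z hz => (Finset.ne_of_mem_erase hz).symm
  have hxe' : ∀ z ∈ u.erase x, x ≠ z := fun z hz => (Finset.ne_of_mem_erase hz).symm
  have hxa : x ≠ a := hxe a (by simp [hab'])
  have hxb : x ≠ b := hxe b (by simp [hab'])
  have hxc : x ≠ c := hxe' c (by simp [hcd'])
  have hxd : x ≠ d := hxe' d (by simp [hcd'])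
  have hdis : ∀ z ∈ t, z ∈ u → z = x := fun z hz hz' => by
    have : z ∈ t ∩ u := Finset.mem_inter.2 ⟨hz, hz'⟩
    simpa [hx] using this
  have hat : a ∉ u := fun k => hxa (hdis a (by simp [hta]) k).symm
  have hbt : b ∉ u := fun k => hxb (hdis b (by simp [hta]) k).symm
  have hct : c ∉ t := fun k => hxc (hdis c k (by simp [hua])).symm
  have hdt : d ∉ t := fun k => hxd (hdis d k (by simp [hua])).symm
  have hcard : (t ∪ u).card = 5 := by
    have := Finset.card_union_add_card_inter t u
    omega
  obtain ⟨g, hg, hgtu⟩ := Finset.exists_mem_notMem_of_card_lt_card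
    (s := t ∪ u) (t := S) (by omega)
  rw [Finset.mem_union, not_or] at hgtu
  obtain ⟨hgt, hgu⟩ := hgtu
  have hne : t ≠ u := fun k => hat (k ▸ (by simp [hta]))
  have hfil : B.triangleFinset.filter (· ⊆ S) = {t, u} := by
    refine (Finset.eq_of_subset_of_card_le ?_ ?_).symm
    · simp [Finset.insert_subset_iff, ht, hu, hts, hus]
    · rw [Finset.card_pair hne]
      exact h2.le
  have key : ∀ p q r, p ∈ S → q ∈ S → r ∈ S → p ≠ q → p ≠ r → q ≠ r →
      (p ∉ t ∨ q ∉ t ∨ r ∉ t) → (p ∉ u ∨ q ∉ u ∨ r ∉ u) → ColTriple B.between p q r := by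
    intro p q r hp hq hr hpq hpr hqr hmt hmu
    refine colTriple_of_spanCount h hp hq hr hpq hpr hqr ?_
    rw [hfil, Finset.mem_insert, Finset.mem_singleton]
    rintro (heq | heq)
    · rw [← heq] at hmt
      simp at hmt
    · rw [← heq] at hmu
      simp at hmu
  have hxS : x ∈ S := hts hxtu.1
  have haS : a ∈ S := hts (by simp [hta])
  have hbS : b ∈ S := hts (by simp [hta])
  have hcS : c ∈ S := hus (by simp [hua])
  have hdS : d ∈ S := hus (by simp [hua])
  have hac : a ≠ c := fun k => hat (by simp [hua, k])
  have had : d ≠ a := fun k => hat (by simp [hua, k])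
  have hbc : b ≠ c := fun k => hbt (by simp [hua, k])
  have hbd : d ≠ b := fun k => hbt (by simp [hua, k])
  have hga : g ≠ a := fun k => hgt (by simp [hta, k])
  have hgb : g ≠ b := fun k => hgt (by simp [hta, k])
  have hgc : g ≠ c := fun k => hgu (by simp [hua, k])
  have hgd : g ≠ d := fun k => hgu (by simp [hua, k])
  have hgx : x ≠ g := fun k => hgu (by simp [hua, k])
  refine not_two_triangles_sharing_point h.laws hab hac hbc had hbd hcd.symm hga hgb hgc hgd hxa hxb hxc
      hxd hgx
    ((mem_triangles_iff h.symm hxa hxb hab).1 (ht' ▸ mem_triangleFinset.1 ht))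
    ((mem_triangles_iff h.symm hxc hxd hcd).1 (hu' ▸ mem_triangleFinset.1 hu)) ?_ ?_ ?_ ?_ ?_ ?_ ?_ ?_ ?_
    ?_ ?_ ?_ ?_ ?_ ?_ ?_ ?_ ?_ <;> apply key <;>
      first
      | assumption
      | exact Ne.symm (by assumption)
      | exact .inl (by assumption)
      | exact .inr (.inl (by assumption))
      | exact .inr (.inr (by assumption))

theorem AlmostMetrizable.sparseTriples [Fintype B.Point] (h : B.AlmostMetrizable) :
    SparseTriples B.triangleFinset where
  card_eq _ ht := (mem_triangleFinset.1 ht).1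
  ne_one _ hS := h.spanCount_ne_one hS
  ne_two _ hS _ ht _ hu hts hus htu := h.spanCount_ne_two hS ht hu hts hus htu

end

theorem coSize_gaps {B : BetweennessStructure} (h : B.AlmostMetrizable) :
    (B.coSize = 0 ∨ B.order ≤ B.coSize + 4) ∧
    (10 ≤ B.order → B.coSize + 2 ≤ B.order ∨ 2 * B.order ≤ B.coSize + 10) := by
  classical
  have := B.finite
  have := Fintype.ofFinite B.Point
  rw [coSize_eq_spanCount, order, Nat.card_eq_fintype_card, ← Finset.card_univ]
  exact ⟨or_iff_not_imp_left.2 h.sparseTriples.card_le_spanCount_add, h.sparseTriples.upper_gap⟩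

end BetweennessStructure

/-! ### Structures realizing the extreme values: lines with doubled points -/

namespace BetweennessStructure

theorem almostMetrizable_of_dist {B : BetweennessStructure} (d : B.Point → B.Point → ℤ)
    (hB : ∀ x y z, B.between x y z ↔ d x y + d y z = d x z)
    (h0 : ∀ x, d x x = 0) (hpos : ∀ x y, d x y ≤ 0 → x = y) (hs : ∀ x y, d x y = d y x)
    (htri : ∀ x y z, d x z ≤ d x y + d y z) : B.AlmostMetrizable where
  refl_left x z := by rw [hB, h0, zero_add]
  symm x y z h := by
    rw [hB] at h ⊢
    rw [hs z y, hs y x, hs z x]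
    omega
  antisymm x y z h1 h2 := by
    rw [hB] at h1 h2
    have := hs x y
    exact hpos x y (by omega)
  four_relations x y z w h1 h2 := by
    rw [hB] at h1 h2 ⊢
    rw [hB]
    have := htri x w z
    have := htri w y z
    omega

section Line
variable {X : Type} (pos : X → ℤ) (s : ℤ)

open Classical in
/-- The distance of points on a line, where distinct points at the same place have distance `s`. -/
noncomputable def lineDist (x y : X) : ℤ :=
  if x = y then 0 else if pos x = pos y then s else max (pos x - pos y) (pos y - pos x)

theorem lineDist_self (x : X) : lineDist pos s x x = 0 := by
  simp [lineDist]

theorem lineDist_comm (x y : X) : lineDist pos s x y = lineDist pos s y x := by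
  rcases eq_or_ne x y with rfl | h
  · rfl
  · simp only [lineDist, h, h.symm, if_false, eq_comm (a := pos x), max_comm (pos x - pos y)]

theorem lineDist_pos {s : ℤ} (hs : 1 ≤ s) {x y : X} (hne : x ≠ y) : 0 < lineDist pos s x y := by
  rw [lineDist, if_neg hne]
  split_ifs <;> omega

/-- The bound `s ≤ 2` is what lets twins be joined through a point at the adjacent integer position.
-/
theorem lineDist_triangle {s : ℤ} (hs : 1 ≤ s) (hs' : s ≤ 2) (x y z : X) :
    lineDist pos s x z ≤ lineDist pos s x y + lineDist pos s y z := by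
  by_cases h1 : x = y
  · rw [h1, lineDist_self, zero_add]
  by_cases h2 : y = z
  · rw [h2, lineDist_self, add_zero]
  rcases eq_or_ne x z with h3 | h3
  · have := lineDist_pos pos hs h1
    have := lineDist_pos pos hs h2
    rw [← h3, lineDist_self] at *
    omega
  simp only [lineDist, h1, h2, h3, if_false]
  split_ifs <;> omega

/-- The betweenness structure of the metric `lineDist pos s`. -/

def lineStructure [Finite X] [Nonempty X] : BetweennessStructure where
  Point := X
  finite := inferInstance
  nonempty := inferInstance
  between x y z := lineDist pos s x y + lineDist pos s y z = lineDist pos s x z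

variable {pos s} [Finite X] [Nonempty X]

theorem almostMetrizable_lineStructure (hs : 1 ≤ s) (hs' : s ≤ 2) :
    (lineStructure pos s).AlmostMetrizable := by
  exact almostMetrizable_of_dist (lineDist pos s) (fun _ _ _ => Iff.rfl) (lineDist_self pos s)
    (fun _ _ h => not_imp_comm.1 (lineDist_pos pos hs) h.not_gt) (lineDist_comm pos s)
    (lineDist_triangle pos hs hs')

theorem colTriple_lineStructure_of_ne {x y z : X}
    (hxy : pos x ≠ pos y) (hxz : pos x ≠ pos z) (hyz : pos y ≠ pos z) :
    ColTriple (lineStructure pos s).between x y z := by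
  have h1 : x ≠ y := fun h => hxy (h ▸ rfl)
  have h2 : x ≠ z := fun h => hxz (h ▸ rfl)
  have h3 : y ≠ z := fun h => hyz (h ▸ rfl)
  simp only [ColTriple, lineStructure, lineDist, h1, h1.symm, h2, h2.symm, h3, h3.symm, hxy, hxy.symm,
    hxz, hxz.symm, hyz, hyz.symm, if_false]
  omega

theorem colTriple_lineStructure_of_eq {x y z : X} (hs : 0 < s)
    (hne : x ≠ y) (hxy : pos x = pos y) (hxz : pos x ≠ pos z) :
    ColTriple (lineStructure pos s).between x y z ↔ 2 * max (pos z - pos x) (pos x - pos z) = s := by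
  have hyz : pos y ≠ pos z := hxy ▸ hxz
  have h2 : x ≠ z := fun h => hxz (h ▸ rfl)
  have h3 : y ≠ z := fun h => hyz (h ▸ rfl)
  simp only [ColTriple, lineStructure, lineDist, hne, hne.symm, h2, h2.symm, h3, h3.symm,
    hyz, hyz.symm, hxy, if_false, if_true]
  omega

/-- A triangle consists of a twin pair and a point elsewhere that is not midway between the twins,
that is, not at distance `s / 2`. The pair and the point are determined by the triangle. -/
theorem coSize_lineStructure [Fintype X] {κ : Type} [Fintype κ] {f : κ → ℤ} {tw : κ → Bool → X}
    (htw : ∀ b e, pos (tw b e) = f b) (hf : Function.Injective f) (htt : ∀ b, tw b false ≠ tw b true)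
    (hex : ∀ x y, x ≠ y → pos x = pos y → ∃ b e, x = tw b e ∧ y = tw b !e) (hs : 1 ≤ s) (hs' : s ≤ 2) :
    ((lineStructure pos s).coSize : ℤ) = ∑ b : κ, ∑ z : X,
      if pos z ≠ f b ∧ 2 * max (pos z - f b) (f b - pos z) ≠ s then 1 else 0 := by
  classical
  have hB : (lineStructure pos s).AlmostMetrizable := almostMetrizable_lineStructure hs hs'
  have hmem : ∀ {a b c : X}, a ≠ b → a ≠ c → b ≠ c →
      (({a, b, c} : Finset X) ∈ (lineStructure pos s).triangles ↔ ¬ ColTriple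
      (lineStructure pos s).between a b c) :=
    fun hab hac hbc => mem_triangles_iff (B := lineStructure pos s) hB.symm hab hac hbc
  set A : Finset (κ × X) := Finset.univ.filter
    fun p => pos p.2 ≠ f p.1 ∧ 2 * max (pos p.2 - f p.1) (f p.1 - pos p.2) ≠ s with hA
  let φ : κ × X → Finset X := fun p => {tw p.1 false, tw p.1 true, p.2}
  have hne : ∀ p ∈ A, ∀ e, tw p.1 e ≠ p.2 := by
    intro p hp e h
    rw [hA, Finset.mem_filter] at hp
    exact hp.2.1 (by rw [← h, htw])
  have himg : (lineStructure pos s).triangles = φ '' A := by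
    refine Set.ext fun (T : Finset X) => ⟨fun hT => ?_, ?_⟩
    · obtain ⟨x, y, z, hxy, hxz, hyz, rfl⟩ := Finset.card_eq_three.1 (show T.card = 3 from hT.1)
      have key : ∀ x y z : X, x ≠ y → x ≠ z → y ≠ z →
          ({x, y, z} : Finset X) ∈ (lineStructure pos s).triangles →
          pos x = pos y → ({x, y, z} : Finset X) ∈ φ '' A := by
        intro x y z hxy hxz hyz hT h
        obtain ⟨b, e, hx, hy⟩ := hex x y hxy h
        have hxp : pos x = f b := by rw [hx, htw]
        have hzp : pos x ≠ pos z := by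
          intro h'
          obtain ⟨b', e', hx', hz⟩ := hex x z hxz h'
          have hbb : b = b' := hf (by rw [← htw b e, ← hx, hx', htw])
          subst hbb
          have hee : e = e' := by
            have := htt b
            have := hx.symm.trans hx'
            cases e <;> cases e' <;> simp_all
          exact hyz (by rw [hy, hz, hee])
        rw [hmem hxy hxz hyz, colTriple_lineStructure_of_eq (by omega) hxy h hzp, hxp] at hT
        refine ⟨(b, z), ?_, ?_⟩
        · rw [hA, Finset.mem_coe, Finset.mem_filter]
          exact ⟨Finset.mem_univ _, fun k => hzp (hxp.trans k.symm), hT⟩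
        · rw [hx, hy]
          cases e
          · rfl
          · exact Finset.insert_comm _ _ _
      by_cases h1 : pos x = pos y
      · exact key x y z hxy hxz hyz hT h1
      by_cases h2 : pos x = pos z
      · have e : ({x, y, z} : Finset X) = {x, z, y} := by
          rw [Finset.pair_comm]
        rw [e] at hT ⊢
        exact key x z y hxz hxy hyz.symm hT h2
      by_cases h3 : pos y = pos z
      · have e : ({x, y, z} : Finset X) = {y, z, x} := by
          rw [Finset.insert_comm, Finset.pair_comm x z]
        rw [e] at hT ⊢
        exact key y z x hyz hxy.symm hxz.symm hT h3
      exact absurd (colTriple_lineStructure_of_ne h1 h2 h3) ((hmem hxy hxz hyz).1 hT)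
    · rintro ⟨p, hp, rfl⟩
      have h1 := hne p hp
      refine (hmem (htt p.1) (h1 _) (h1 _)).2 ?_
      rw [hA, Finset.mem_coe, Finset.mem_filter] at hp
      rw [colTriple_lineStructure_of_eq (by omega) (htt p.1) (by rw [htw, htw])
        (by rw [htw]; exact hp.2.1.symm), htw]
      exact hp.2.2
  have hφ : Set.InjOn φ A := by
    rintro ⟨b, z⟩ hp ⟨b', z'⟩ hp' h
    have h1 := hne _ hp
    have h3 := hne _ hp'
    simp only [φ, Finset.ext_iff, Finset.mem_insert, Finset.mem_singleton] at h h1 h3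
    have hb : b = b' := by
      by_contra hb
      have n : ∀ e e', tw b e ≠ tw b' e' := by
        intro e e' k
        exact hb (hf (by rw [← htw b e, k, htw]))
      have a1 := (h (tw b false)).1 (.inl rfl)
      have a2 := (h (tw b true)).1 (.inr (.inl rfl))
      have a3 := (a1.resolve_left (n _ _)).resolve_left (n _ _)
      have a4 := (a2.resolve_left (n _ _)).resolve_left (n _ _)
      exact htt b (a3.trans a4.symm)
    subst hb
    have := ((h z).1 (.inr (.inr rfl))).resolve_left (h1 _).symm |>.resolve_left (h1 _).symm
    rw [this]
  have hc : (lineStructure pos s).coSize = A.card :=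
    (congrArg Set.ncard himg).trans (hφ.ncard_image.trans (Set.ncard_coe_finset A))
  rw [hc, hA, Finset.card_filter, Fintype.sum_prod_type]
  push_cast
  rfl

theorem ofOrderCoSize_nonempty_of_twins {κ : Type} [Fintype κ] {q : ℕ} {f : κ → ℤ} {g : Fin q → ℤ} {n m : ℤ}
    (hinj : Function.Injective (Sum.elim f g)) (hs : 1 ≤ s) (hs' : s ≤ 2)
    (hn : n = 2 * Fintype.card κ + q) (hn0 : 1 ≤ n)
    (hm : m = ∑ b : κ, (2 * (∑ b' : κ, if f b' ≠ f b ∧ 2 * max (f b' - f b)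
    (f b - f b') ≠ s then 1 else 0) +
      ∑ i : Fin q, if g i ≠ f b ∧ 2 * max (g i - f b) (f b - g i) ≠ s then 1 else 0)) :
    (ofOrderCoSize n m).Nonempty := by
  have hcard : (Fintype.card (κ × Bool ⊕ Fin q) : ℤ) = n := by
    simp [hn, mul_comm]
  have : Nonempty (κ × Bool ⊕ Fin q) := Fintype.card_pos_iff.1 (by omega)
  have hB := almostMetrizable_lineStructure (pos := Sum.elim (fun p : κ × Bool => f p.1) g) hs hs'
  refine ⟨_, hB, ?_, ?_⟩
  · rw [← hcard, order, ← Nat.card_eq_fintype_card]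
    rfl
  · rw [coSize_lineStructure (f := f) (tw := fun b e => .inl (b, e)) (fun _ _ => rfl)
      (hinj.comp Sum.inl_injective) (by simp) ?_ hs hs', hm]
    · refine Finset.sum_congr rfl fun b _ => ?_
      rw [Fintype.sum_sum_type, Fintype.sum_prod_type, two_mul, ← Finset.sum_add_distrib]
      simp only [Fintype.sum_bool]
      rfl
    · have key : ∀ u v : κ ⊕ Fin q, Sum.elim f g u = Sum.elim f g v → u = v := fun u v h => hinj h
      rintro (⟨b, e⟩ | i) (⟨b', e'⟩ | j) hne h
      · have := Sum.inl_injective (key (.inl b) (.inl b') h)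
        subst this
        refine ⟨b, e, rfl, ?_⟩
        cases e <;> cases e' <;> simp_all
      · exact absurd (key (.inl b) (.inr j) h) (by simp)
      · exact absurd (key (.inr i) (.inl b') h) (by simp)
      · exact absurd (congrArg Sum.inr (Sum.inr_injective (key (.inr i) (.inr j) h))) hne

end Line

theorem sum_ite_one_of_forall {n : ℕ} {P : Fin n → Prop} [DecidablePred P] (h : ∀ i, P i) :
    ∑ i, (if P i then (1 : ℤ) else 0) = n := by
  simp [h]

theorem nonempty_ofOrderCoSize_zero {n : ℤ} (hn : 1 ≤ n) : (ofOrderCoSize n (0)).Nonempty := by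
  obtain ⟨r, rfl⟩ : ∃ r : ℕ, n = r + 1 := ⟨(n - 1).toNat, by omega⟩
  refine ofOrderCoSize_nonempty_of_twins (κ := Fin 0) (f := fun _ => 0) (g := fun i : Fin (r + 1) =>
      (i : ℤ))
    (s := 2) ?_ (by norm_num) (by norm_num) (by rw [Fintype.card_fin]; omega) (by omega) ?_
  · rintro (i | i) (j | j) h <;> have := i.isLt <;> have := j.isLt <;>
      simp only [Sum.elim_inl, Sum.elim_inr] at h <;>
      simp only [Sum.inl.injEq, Sum.inr.injEq, reduceCtorEq, Fin.ext_iff] <;> omega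
  · simp

/-- For `s = 1` no integer point is midway between the twins, so all `n - 2` others give triangles.
-/
theorem nonempty_ofOrderCoSize_sub_two {n : ℤ} (hn : 2 ≤ n) : (ofOrderCoSize n (n - 2)).Nonempty := by
  obtain ⟨r, rfl⟩ : ∃ r : ℕ, n = r + 2 := ⟨(n - 2).toNat, by omega⟩
  refine ofOrderCoSize_nonempty_of_twins (κ := Fin 1) (f := fun _ => 0) (g := fun i : Fin (r) =>
      (i : ℤ) + 1)
    (s := 1) ?_ (by norm_num) (by norm_num) (by rw [Fintype.card_fin]; omega) (by omega) ?_
  · rintro (i | i) (j | j) h <;> have := i.isLt <;> have := j.isLt <;>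
      simp only [Sum.elim_inl, Sum.elim_inr] at h <;>
      simp only [Sum.inl.injEq, Sum.inr.injEq, reduceCtorEq, Fin.ext_iff] <;> omega
  · simp only [Fin.sum_univ_one]
    rw [sum_ite_one_of_forall fun i => by omega]
    simp

/-- For `s = 2` the neighbours of a twin pair are midway; a pair at the end of the line has one. -/
theorem nonempty_ofOrderCoSize_sub_three {n : ℤ} (hn : 3 ≤ n) : (ofOrderCoSize n (n - 3)).Nonempty := by
  obtain ⟨r, rfl⟩ : ∃ r : ℕ, n = r + 3 := ⟨(n - 3).toNat, by omega⟩
  refine ofOrderCoSize_nonempty_of_twins (κ := Fin 1) (f := fun _ => 0) (g := fun i : Fin (r + 1) =>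
      (i : ℤ) + 1)
    (s := 2) ?_ (by norm_num) (by norm_num) (by rw [Fintype.card_fin]; omega) (by omega) ?_
  · rintro (i | i) (j | j) h <;> have := i.isLt <;> have := j.isLt <;>
      simp only [Sum.elim_inl, Sum.elim_inr] at h <;>
      simp only [Sum.inl.injEq, Sum.inr.injEq, reduceCtorEq, Fin.ext_iff] <;> omega
  · simp only [Fin.sum_univ_one]
    rw [Fin.sum_univ_succ, sum_ite_one_of_forall fun i => by rw [Fin.val_succ]; omega]
    simp

/-- The twins sit at `1`, with single neighbours at `0` and `2` both midway. -/
theorem nonempty_ofOrderCoSize_sub_four {n : ℤ} (hn : 4 ≤ n) : (ofOrderCoSize n (n - 4)).Nonempty := by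
  obtain ⟨r, rfl⟩ : ∃ r : ℕ, n = r + 4 := ⟨(n - 4).toNat, by omega⟩
  refine ofOrderCoSize_nonempty_of_twins (κ := Fin 1) (f := fun _ => 1) (g := fun i : Fin (r + 2) => if
      (i : ℕ) = 0 then 0 else (i : ℤ) + 1)
    (s := 2) ?_ (by norm_num) (by norm_num) (by rw [Fintype.card_fin]; omega) (by omega) ?_
  · rintro (i | i) (j | j) h <;> have := i.isLt <;> have := j.isLt <;>
      simp only [Sum.elim_inl, Sum.elim_inr] at h <;>
      simp only [Sum.inl.injEq, Sum.inr.injEq, reduceCtorEq, Fin.ext_iff] <;> (try split_ifs at h) <;> omega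
  · simp only [Fin.sum_univ_one]
    rw [Fin.sum_univ_succ, Fin.sum_univ_succ, sum_ite_one_of_forall fun i => by
      simp only [Fin.val_succ, Nat.succ_ne_zero, if_false]; omega]
    simp

/-- Twin pairs at `1` and `2`, single points at `0, 3, 4, …`. Each pair has three points midway,
namely the other pair and one single point, and so lies in `n - 5` triangles. -/
theorem nonempty_ofOrderCoSize_two_mul_sub {n : ℤ} (hn : 6 ≤ n) : (ofOrderCoSize n
    (2 * n - 10)).Nonempty := by
  obtain ⟨r, rfl⟩ : ∃ r : ℕ, n = r + 6 := ⟨(n - 6).toNat, by omega⟩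
  refine ofOrderCoSize_nonempty_of_twins (κ := Fin 2) (f := fun b => (b : ℤ) + 1) (g := fun i : Fin
      (r + 2) => if (i : ℕ) = 0 then 0 else (i : ℤ) + 2)
    (s := 2) ?_ (by norm_num) (by norm_num) (by rw [Fintype.card_fin]; omega) (by omega) ?_
  · rintro (i | i) (j | j) h <;> have := i.isLt <;> have := j.isLt <;>
      simp only [Sum.elim_inl, Sum.elim_inr] at h <;>
      simp only [Sum.inl.injEq, Sum.inr.injEq, reduceCtorEq, Fin.ext_iff] <;> (try split_ifs at h) <;> omega
  · simp only [Fin.sum_univ_two]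
    rw [Fin.sum_univ_succ, Fin.sum_univ_succ, sum_ite_one_of_forall fun i => by
      simp only [Fin.val_succ, Nat.succ_ne_zero, if_false, Fin.val_zero]; omega,
      Fin.sum_univ_succ, Fin.sum_univ_succ, sum_ite_one_of_forall fun i => by
      simp only [Fin.val_succ, Nat.succ_ne_zero, if_false, Fin.val_one]; omega]
    simp
    ring

/-! ### Evaluation of the extremal functions -/

theorem bound_of_mem {n m : ℤ} (h : (ofOrderCoSize n m).Nonempty) : 1 ≤ n ∧ 0 ≤ m ∧ (m = 0 ∨ n ≤ m + 4) ∧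
    (10 ≤ n → m + 2 ≤ n ∨ 2 * n ≤ m + 10) := by
  obtain ⟨B, hB, rfl, rfl⟩ := h
  obtain ⟨h1, h2⟩ := coSize_gaps hB
  have : 0 < B.order := by
    have := B.finite
    have := B.nonempty
    exact Nat.card_pos
  omega

theorem not_bddAbove_of_Ici {S : Set ℤ} (a : ℤ) (h : ∀ n, a ≤ n → n ∈ S) : ¬ BddAbove S := by
  rintro ⟨M, hM⟩
  have := hM (h (max a (M + 1)) (le_max_left _ _))
  omega

theorem gamma_one (c : ℤ) : gamma 1 c = if c < 2 then toExt (10 - c) else if c ≤ 4 then ⊤ else toExt c := by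
  unfold gamma
  split_ifs with h1 h2
  · rw [extMax_eq_toExt_iff]
    constructor
    -- `2n - 10 = n - c` exactly at `n = 10 - c`. In the upper bound, orders below `10` are harmless
    -- because `10 - c ≥ 9`.
    · have := nonempty_ofOrderCoSize_two_mul_sub (n := 10 - c) (by omega)
      rw [Set.mem_ofPred_eq]
      convert this using 2
      ring
    · intro n hn
      have := bound_of_mem hn
      omega
  · rw [extMax_eq_top_iff]
    refine not_bddAbove_of_Ici 4 fun n hn => ?_
    rw [Set.mem_ofPred_eq, one_mul]
    obtain rfl | rfl | rfl : c = 2 ∨ c = 3 ∨ c = 4 := by omega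
    · exact nonempty_ofOrderCoSize_sub_two (by omega)
    · exact nonempty_ofOrderCoSize_sub_three (by omega)
    · exact nonempty_ofOrderCoSize_sub_four (by omega)
  · rw [extMax_eq_toExt_iff]
    constructor
    · have := nonempty_ofOrderCoSize_zero (n := c) (by omega)
      rw [Set.mem_ofPred_eq]
      convert this using 2
      ring
    · intro n hn
      have := bound_of_mem hn
      omega

theorem sigma_one (c : ℤ) : sigma 1 c = if 2 ≤ c ∧ c ≤ 4 then toExt (c - 1) else ⊤ := by
  unfold sigma
  split_ifs with h
  · rw [extMax_eq_toExt_iff]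
    constructor
    · rw [Set.mem_ofPred_eq, ← Set.not_nonempty_iff_eq_empty]
      intro h'
      have := bound_of_mem h'
      omega
    · intro n hn
      by_contra! hlt
      rw [Set.mem_ofPred_eq, ← Set.not_nonempty_iff_eq_empty, one_mul] at hn
      apply hn
      obtain rfl | rfl | rfl : c = 2 ∨ c = 3 ∨ c = 4 := by omega
      · exact nonempty_ofOrderCoSize_sub_two (by omega)
      · exact nonempty_ofOrderCoSize_sub_three (by omega)
      · exact nonempty_ofOrderCoSize_sub_four (by omega)
  · rw [extMax_eq_top_iff]
    -- Beyond this order `n ≥ 10`, `n > c` and `n > 10 - c`, so `n - c` falls in one of the gaps.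
    refine not_bddAbove_of_Ici (11 + |c|) fun n hn => ?_
    rw [Set.mem_ofPred_eq, ← Set.not_nonempty_iff_eq_empty]
    intro h'
    have := bound_of_mem h'
    have := le_abs_self c
    have := neg_abs_le c
    omega

theorem gamma_one_eq_top_iff (c : ℤ) : gamma 1 c = ⊤ ↔ 2 ≤ c ∧ c ≤ 4 := by
  have h (a : ℤ) : toExt a ≠ ⊤ := fun h => WithTop.coe_ne_top (WithBot.coe_injective h)
  rw [gamma_one]
  split_ifs with h1 h2
  · simp only [h, false_iff]
    omega
  · simp only [true_iff]
    omega
  · simp only [h, false_iff]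
    omega

end BetweennessStructure

theorem corollary1 :
    BetweennessStructure.IsThetaMin 1 2 ∧
    BetweennessStructure.IsThetaMax 1 4 ∧
    (∀ c : ℤ, BetweennessStructure.sigma 1 c =
      if 2 ≤ c ∧ c ≤ 4 then BetweennessStructure.toExt (c - 1) else ⊤) ∧
    (∀ c : ℤ, BetweennessStructure.gamma 1 c =
      if c < 2 then BetweennessStructure.toExt (10 - c)
      else if c ≤ 4 then ⊤
      else BetweennessStructure.toExt c) := by
  refine ⟨?_, ?_, BetweennessStructure.sigma_one, BetweennessStructure.gamma_one⟩
  · exact ⟨(BetweennessStructure.gamma_one_eq_top_iff 2).2 (by norm_num),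
      fun c hc => ((BetweennessStructure.gamma_one_eq_top_iff c).1 hc).1⟩
  · exact ⟨(BetweennessStructure.gamma_one_eq_top_iff 4).2 (by norm_num),
      fun c hc => ((BetweennessStructure.gamma_one_eq_top_iff c).1 hc).2⟩
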